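/- Let $a,b$ be two generators of odd positive degrees $\deg a,\deg b\in\mathbb{N}$, and let $\mathbb{L}=\mathbb{L}_{\langle a,b\rangle}$ be the free graded Lie algebra over $\mathbb{Q}$ on $a,b$, i.e. the graded Lie subalgebra generated by $a,b$ in the tensor algebra $T\langle a,b\rangle$ with the graded commutator $[x,y]=xy-(-1)^{\deg x\deg y}yx$. Let $\mathbb{L}^{\mathrm{wl}_b=2}$ be the span of all iterated brackets in $a,b$ in which $b$ occurs exactly twice, and let $(\mathbb{L}^{\mathrm{wl}_b=2})^{\mathrm{wl}=n}$ be its subspace of elements of word length $n$, i.e. its intersection with the span of all iterated brackets with exactly $n$ letters (counted with multiplicity). For $i,j\ge 1$ put $$[i,j]:=\big[\mathrm{ad}^{i-1}(a)(b),\ \mathrm{ad}^{j-1}(a)(b)\big],$$ so that the two inner brackets have $i$ and $j$ letters. Then the following hold. (1) The elements $[i,n-i]$, where $n\geq 1$ and $1\le i\le m(n)$ with $$m(n)=\begin{cases}\frac n2-1 & n\equiv 0 \pmod 4,\\ \frac{n-1}{2} & n\equiv 1,3 \pmod 4,\\ \frac n2 & n\equiv 2 \pmod 4,\end{cases}$$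 form a homogeneous basis of $\mathbb{L}^{\mathrm{wl}_b=2}$, the element $[i,n-i]$ being of degree $(n-2)\deg a+2\deg b$. (2) For every $n\ge 1$ a basis of $(\mathbb{L}^{\mathrm{wl}_b=2})^{\mathrm{wl}=n}$ is given by $\{[1,n-1],[2,n-2],\dots,[m(n),n-m(n)]\}$, that is, by $$\begin{cases}\{[1,n-1],\dots,[\frac n2-1,\frac n2+1]\} & n\equiv 0 \pmod 4,\\ \{[1,n-1],\dots,[\frac{n-1}2,\frac{n+1}2]\} & n\equiv 1,3 \pmod 4,\\ \{[1,n-1],\dots,[\frac n2,\frac n2]\} & n\equiv 2 \pmod 4\end{cases}$$ (the empty set if $n=1$). (3) Consequently, for every $n\ge 1$, $$\dim(\mathbb{L}^{\mathrm{wl}_b=2})^{\mathrm{wl}=n}=\begin{cases}\frac n2-1 & n\equiv 0 \pmod 4,\\ \frac{n-1}{2} & n\equiv 1,3 \pmod 4,\\ \frac n2 & n\equiv 2 \pmod 4.\end{cases}$$ -/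

import Mathlib

namespace FreeGradedLie

/-- The tensor algebra `T V` over `ℚ` on the graded vector space `V` with basis `X`
(the degree function `d : X → ℕ` enters only through the definitions below). -/
abbrev Tens (X : Type) : Type := FreeAlgebra ℚ X

/-- The word `x₁ ⋯ xₘ` as an element of the tensor algebra. -/
def word {X : Type} (w : List X) : Tens X := (w.map (FreeAlgebra.ι ℚ)).prod

/-- The homogeneous part of degree `k` of the tensor algebra: the span of all words
of total degree `k`, where the letter `x` has degree `d x`. -/
def tensDeg {X : Type} (d : X → ℕ) (k : ℕ) : Submodule ℚ (Tens X) :=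
  Submodule.span ℚ {u | ∃ w : List X, (w.map d).sum = k ∧ u = word w}

/-- The parity involution: the algebra automorphism `u ↦ (-1)^{deg u} u`. -/
noncomputable def parity {X : Type} (d : X → ℕ) : Tens X →ₐ[ℚ] Tens X :=
  FreeAlgebra.lift ℚ (fun x => ((-1 : ℚ) ^ d x) • FreeAlgebra.ι ℚ x)

/-- The graded commutator of the tensor algebra, as a bilinear map. On homogeneous elements it is
`u v - (-1)^{deg u * deg v} v u`, see `gradedComm_of_homogeneous`. -/
noncomputable def gradedComm {X : Type} (d : X → ℕ) : Tens X →ₗ[ℚ] Tens X →ₗ[ℚ] Tens X :=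
  LinearMap.mk₂ ℚ
    (fun u v => u * v - (1 / 2 : ℚ) •
      (v * u + parity d v * u + v * parity d u - parity d v * parity d u))
    (by intro u u' v; simp only [map_add, mul_add, add_mul]; module)
    (by intro c u v; simp only [map_smul, mul_smul_comm, smul_mul_assoc]; module)
    (by intro u v v'; simp only [map_add, mul_add, add_mul]; module)
    (by intro c u v; simp only [map_smul, mul_smul_comm, smul_mul_assoc]; module)

theorem parity_of_homogeneous {X : Type} (d : X → ℕ) {k : ℕ} {u : Tens X}
    (hu : u ∈ tensDeg d k) : parity d u = ((-1 : ℚ) ^ k) • u := by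
  have hw : ∀ w : List X, parity d (word w) = ((-1 : ℚ) ^ (w.map d).sum) • word w := by
    intro w
    induction w with
    | nil => simp [word]
    | cons x w ih =>
      have h : word (x :: w) = FreeAlgebra.ι ℚ x * word w := by simp [word]
      rw [h, map_mul, ih]
      simp [parity, pow_add, smul_smul, mul_comm]
  refine Submodule.span_induction (p := fun u _ => parity d u = ((-1 : ℚ) ^ k) • u)
    ?_ ?_ ?_ ?_ hu
  · rintro _ ⟨w, rfl, rfl⟩
    exact hw w
  · simp
  · intro x y _ _ hx hy
    rw [map_add, hx, hy, smul_add]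
  · intro c x _ hx
    rw [map_smul, hx, smul_comm]

theorem gradedComm_of_homogeneous {X : Type} (d : X → ℕ) {k l : ℕ} {u v : Tens X}
    (hu : u ∈ tensDeg d k) (hv : v ∈ tensDeg d l) :
    gradedComm d u v = u * v - ((-1 : ℚ) ^ (k * l)) • (v * u) := by
  simp only [gradedComm, LinearMap.mk₂_apply, parity_of_homogeneous d hu,
    parity_of_homogeneous d hv]
  rw [pow_mul]
  rcases neg_one_pow_eq_or ℚ k with hk | hk <;> rcases neg_one_pow_eq_or ℚ l with hl | hl <;>
    simp only [hk, hl, one_pow, smul_mul_assoc, mul_smul_comm] <;> module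

/-- The free graded Lie algebra on the graded vector space with basis `X` and degrees `d`, as a
subspace of the tensor algebra: the smallest subspace which contains the generators and is closed
under the graded commutator, i.e. the graded Lie subalgebra generated by them. -/
def lieSub {X : Type} (d : X → ℕ) : Submodule ℚ (Tens X) :=
  sInf {S | (∀ x, FreeAlgebra.ι ℚ x ∈ S) ∧ ∀ u ∈ S, ∀ v ∈ S, gradedComm d u v ∈ S}

theorem ι_mem_lieSub {X : Type} (d : X → ℕ) (x : X) : FreeAlgebra.ι ℚ x ∈ lieSub d := by
  rw [lieSub, Submodule.mem_sInf]
  exact fun S hS => hS.1 x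

theorem gradedComm_mem_lieSub {X : Type} (d : X → ℕ) {u v : Tens X}
    (hu : u ∈ lieSub d) (hv : v ∈ lieSub d) : gradedComm d u v ∈ lieSub d := by
  rw [lieSub, Submodule.mem_sInf] at *
  exact fun S hS => hS.2 u (hu S hS) v (hv S hS)

/-- The free graded Lie algebra `𝕃_{⟨X⟩}`, as a rational vector space. -/
abbrev FreeLie {X : Type} (d : X → ℕ) : Type := ↥(lieSub d)

/-- The generators of the free graded Lie algebra. -/
def gen {X : Type} (d : X → ℕ) (x : X) : FreeLie d :=
  ⟨FreeAlgebra.ι ℚ x, ι_mem_lieSub d x⟩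

/-- The Lie bracket of the free graded Lie algebra. -/
noncomputable def lie {X : Type} (d : X → ℕ) (u v : FreeLie d) : FreeLie d :=
  ⟨gradedComm d u.1 v.1, gradedComm_mem_lieSub d u.2 v.2⟩

/-- `ad^j(u)(v)`, the `j`-fold iterated bracketing of `v` with `u`. -/
noncomputable def adPow {X : Type} (d : X → ℕ) (j : ℕ) (u v : FreeLie d) : FreeLie d :=
  (lie d u)^[j] v

/-- The homogeneous part of degree `k` of the free graded Lie algebra. -/
def degPart {X : Type} (d : X → ℕ) (k : ℕ) : Submodule ℚ (FreeLie d) :=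
  (tensDeg d k).comap (lieSub d).subtype

/-- The value in the free graded Lie algebra of a bracket monomial, that is of a
parenthesized word in the generators. -/
noncomputable def monomial {X : Type} (d : X → ℕ) : FreeMagma X → FreeLie d
  | .of x => gen d x
  | .mul s t => lie d (monomial d s) (monomial d t)

/-- The number of occurrences of the generator `x` in a bracket monomial. -/
def occ {X : Type} [DecidableEq X] (x : X) : FreeMagma X → ℕ
  | .of y => if y = x then 1 else 0
  | .mul s t => occ x s + occ x t

/-- The subspace of elements of word length `n`: the span of the bracket monomials with `n` letters,
counted with multiplicity. -/
def wlPart {X : Type} (d : X → ℕ) (n : ℕ) : Submodule ℚ (FreeLie d) :=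
  Submodule.span ℚ {u | ∃ m : FreeMagma X, m.length = n ∧ u = monomial d m}

/-- The subspace of elements of word length `k` in the generator `x`: the span of the bracket
monomials in which `x` occurs exactly `k` times. -/
def wlPartIn {X : Type} [DecidableEq X] (d : X → ℕ) (x : X) (k : ℕ) :
    Submodule ℚ (FreeLie d) :=
  Submodule.span ℚ {u | ∃ m : FreeMagma X, occ x m = k ∧ u = monomial d m}

/-- With two generators `a = 0` and `b = 1`: the element
`[i, j] = [[a,[a,…,[a,b]…]], [a,[a,…,[a,b]…]]]` (`i, j ≥ 1`), in which the two inner brackets have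
`i` and `j` letters, `b` included; that is `[ad^{i-1}(a)(b), ad^{j-1}(a)(b)]`. -/
noncomputable def br (d : Fin 2 → ℕ) (i j : ℕ) : FreeLie d :=
  lie d (adPow d (i - 1) (gen d 0) (gen d 1)) (adPow d (j - 1) (gen d 0) (gen d 1))

/-- The last index `i` of the basis elements `[i, n - i]` of word length `n`. -/
def lastIndex (n : ℕ) : ℕ :=
  if n % 4 = 0 then n / 2 - 1 else if n % 4 = 2 then n / 2 else (n - 1) / 2

end FreeGradedLie

/-!
Write `xᵢ = ad^i(a)(b)`, an element of the parity of `i + 1`, so that `[i, j] = [xᵢ₋₁, xⱼ₋₁]`.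

*Spanning.* By the graded Jacobi identity, and since `[[a, a], u] = 2 [a, [a, u]]` and
`[a, [a, a]] = 0` for the odd generator `a`, the bracket monomials with no, one or two letters `b`
lie in the spans of `a, [a, a]`, of the `xᵢ`, and of the `[xᵢ, xⱼ]` respectively
(`monomial_mem_span_spanners`). Antisymmetry reduces the latter to `i ≤ j`, and `[xᵢ, xᵢ] = 0` if
`xᵢ` is even, that is if `i` is odd. What is left are the brackets of the theorem
(`gradedComm_adB_mem_span`).

*Independence.* The tensor algebra acts on the free algebra on symbols `x₀, x₁, …`, with `a` acting
as the odd derivation `xᵢ ↦ xᵢ₊₁` and `b` as left multiplication by `x₀`. The graded commutator of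
the derivation with the multiplication by `xᵢ` is the multiplication by `xᵢ₊₁`, so `ad^i(a)(b)` acts
as the multiplication by `xᵢ` (`action_adB`), and `[xᵢ, xⱼ]` sends `1` to `xᵢxⱼ ∓ xⱼxᵢ`. For
`i ≤ j` these are independent, apart from those with `i = j` odd, which vanish
(`linearIndependent_brFamily`). Only products of at most two symbols matter, so a truncation of the
free algebra is enough.

*Word length.* The automorphism which doubles all generators acts as `2 ^ n` on word length `n`.
Hence an element of word length `n` involves only the basis elements `[i, n - i]` of that word
length (`span_brFamily_inf`).
-/

namespace FreeGradedLie

open Submodule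

/-! ### The graded commutator on homogeneous elements -/

theorem tensDeg_mul {X : Type} (d : X → ℕ) {k l : ℕ} {u v : Tens X}
    (hu : u ∈ tensDeg d k) (hv : v ∈ tensDeg d l) : u * v ∈ tensDeg d (k + l) := by
  have h : tensDeg d k * tensDeg d l ≤ tensDeg d (k + l) := by
    rw [tensDeg, tensDeg, span_mul_span, span_le]
    rintro _ ⟨_, ⟨w, rfl, rfl⟩, _, ⟨w', rfl, rfl⟩, rfl⟩
    exact subset_span ⟨w ++ w', by simp, by simp [word]⟩
  exact h (mul_mem_mul hu hv)

theorem ι_mem_tensDeg {X : Type} (d : X → ℕ) (x : X) : FreeAlgebra.ι ℚ x ∈ tensDeg d (d x) :=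
  subset_span ⟨[x], by simp, by simp [word]⟩

theorem gradedComm_mem_tensDeg {X : Type} (d : X → ℕ) {k l : ℕ} {u v : Tens X}
    (hu : u ∈ tensDeg d k) (hv : v ∈ tensDeg d l) : gradedComm d u v ∈ tensDeg d (k + l) := by
  rw [gradedComm_of_homogeneous d hu hv]
  exact sub_mem (tensDeg_mul d hu hv) (smul_mem _ _ (add_comm l k ▸ tensDeg_mul d hv hu))

theorem gradedComm_swap {X : Type} (d : X → ℕ) {k l : ℕ} {u v : Tens X}
    (hu : u ∈ tensDeg d k) (hv : v ∈ tensDeg d l) :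
    gradedComm d v u = (-(-1 : ℚ) ^ (k * l)) • gradedComm d u v := by
  rw [gradedComm_of_homogeneous d hu hv, gradedComm_of_homogeneous d hv hu, mul_comm l k]
  rcases neg_one_pow_eq_or ℚ (k * l) with h | h <;> rw [h] <;> module

/-- Bracketing with `u` is a derivation up to the Koszul sign: the graded Jacobi identity. -/
theorem gradedComm_gradedComm {X : Type} (d : X → ℕ) {k l m : ℕ} {u v w : Tens X}
    (hu : u ∈ tensDeg d k) (hv : v ∈ tensDeg d l) (hw : w ∈ tensDeg d m) :
    gradedComm d u (gradedComm d v w) =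
      gradedComm d (gradedComm d u v) w + (-1 : ℚ) ^ (k * l) •
        gradedComm d v (gradedComm d u w) := by
  rw [gradedComm_of_homogeneous d hu (gradedComm_mem_tensDeg d hv hw),
    gradedComm_of_homogeneous d (gradedComm_mem_tensDeg d hu hv) hw,
    gradedComm_of_homogeneous d hv (gradedComm_mem_tensDeg d hu hw),
    gradedComm_of_homogeneous d hu hv, gradedComm_of_homogeneous d hv hw,
    gradedComm_of_homogeneous d hu hw]
  simp only [mul_add, add_mul, pow_add, mul_comm l k]
  rcases neg_one_pow_eq_or ℚ (k * l) with h | h <;>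
  rcases neg_one_pow_eq_or ℚ (k * m) with h' | h' <;>
  rcases neg_one_pow_eq_or ℚ (l * m) with h'' | h'' <;>
  simp only [h, h', h'', mul_sub, sub_mul, mul_smul_comm, smul_mul_assoc, mul_assoc] <;> module

theorem gradedComm_self_gradedComm {X : Type} (d : X → ℕ) {k m : ℕ} (hk : Odd k) {u w : Tens X}
    (hu : u ∈ tensDeg d k) (hw : w ∈ tensDeg d m) :
    gradedComm d (gradedComm d u u) w = (2 : ℚ) • gradedComm d u (gradedComm d u w) := by
  have h := gradedComm_gradedComm d hu hu hw
  rw [(hk.mul hk).neg_one_pow, ← sub_eq_iff_eq_add] at h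
  rw [← h]
  module

theorem gradedComm_self_right {X : Type} (d : X → ℕ) {k : ℕ} (hk : Odd k) {u : Tens X}
    (hu : u ∈ tensDeg d k) : gradedComm d u (gradedComm d u u) = 0 := by
  rw [gradedComm_of_homogeneous d hu (gradedComm_mem_tensDeg d hu hu),
    gradedComm_of_homogeneous d hu hu, (hk.mul hk).neg_one_pow, mul_add, pow_add,
    (hk.mul hk).neg_one_pow]
  simp [mul_add, add_mul, mul_assoc]

/-! ### The iterated brackets of `b` with `a` -/

/-- The element `ad^i(a)(b)` of the tensor algebra, where `a = 0` and `b = 1`. -/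
noncomputable def adB (d : Fin 2 → ℕ) : ℕ → Tens (Fin 2)
  | 0 => FreeAlgebra.ι ℚ 1
  | i + 1 => gradedComm d (FreeAlgebra.ι ℚ 0) (adB d i)

theorem adPow_gen_coe (d : Fin 2 → ℕ) (i : ℕ) : (adPow d i (gen d 0) (gen d 1)).1 = adB d i := by
  induction i with
  | zero => rfl
  | succ i ih =>
    rw [adPow, Function.iterate_succ_apply', ← adPow, adB, ← ih]
    rfl

theorem br_coe (d : Fin 2 → ℕ) (i j : ℕ) :
    (br d i j).1 = gradedComm d (adB d (i - 1)) (adB d (j - 1)) := by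
  rw [← adPow_gen_coe, ← adPow_gen_coe]
  rfl

theorem adB_mem_tensDeg (d : Fin 2 → ℕ) (i : ℕ) : adB d i ∈ tensDeg d (i * d 0 + d 1) := by
  induction i with
  | zero => simpa [adB] using ι_mem_tensDeg d 1
  | succ i ih =>
    rw [show (i + 1) * d 0 + d 1 = d 0 + (i * d 0 + d 1) by ring]
    exact gradedComm_mem_tensDeg d (ι_mem_tensDeg d 0) ih

theorem neg_one_pow_degree_adB {d : Fin 2 → ℕ} (ha : Odd (d 0)) (hb : Odd (d 1)) (i : ℕ) :
    (-1 : ℚ) ^ (i * d 0 + d 1) = (-1) ^ (i + 1) := by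
  rw [pow_add, mul_comm i, pow_mul, ha.neg_one_pow, hb.neg_one_pow, pow_succ]

theorem gradedComm_adB {d : Fin 2 → ℕ} (ha : Odd (d 0)) (hb : Odd (d 1)) (i j : ℕ) :
    gradedComm d (adB d i) (adB d j) =
      adB d i * adB d j - ((-1 : ℚ) ^ ((i + 1) * (j + 1))) • (adB d j * adB d i) := by
  rw [gradedComm_of_homogeneous d (adB_mem_tensDeg d i) (adB_mem_tensDeg d j), pow_mul,
    neg_one_pow_degree_adB ha hb, ← pow_mul, mul_comm (i + 1), pow_mul,
    neg_one_pow_degree_adB ha hb, ← pow_mul, mul_comm (j + 1)]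

/-! ### Brackets with at most two letters `b` -/

/-- A spanning set for the values of the bracket monomials with `k ≤ 2` letters `b`: the elements
`a` and `[a, a]`, the elements `ad^i(a)(b)`, and the pairwise brackets of the latter. The value for
`k > 2` is arbitrary. -/
def spanners (d : Fin 2 → ℕ) : ℕ → Set (Tens (Fin 2))
  | 0 => {FreeAlgebra.ι ℚ 0, gradedComm d (FreeAlgebra.ι ℚ 0) (FreeAlgebra.ι ℚ 0)}
  | 1 => Set.range (adB d)
  | 2 => Set.range fun p : ℕ × ℕ => gradedComm d (adB d p.1) (adB d p.2)
  | _ => Set.univ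

theorem exists_mem_tensDeg_of_mem_spanners (d : Fin 2 → ℕ) {k : ℕ} (hk : k ≤ 2)
    {u : Tens (Fin 2)} (hu : u ∈ spanners d k) : ∃ l, u ∈ tensDeg d l := by
  interval_cases k
  · rcases hu with rfl | rfl
    · exact ⟨_, ι_mem_tensDeg d 0⟩
    · exact ⟨_, gradedComm_mem_tensDeg d (ι_mem_tensDeg d 0) (ι_mem_tensDeg d 0)⟩
  · obtain ⟨i, rfl⟩ := hu
    exact ⟨_, adB_mem_tensDeg d i⟩
  · obtain ⟨p, rfl⟩ := hu
    exact ⟨_, gradedComm_mem_tensDeg d (adB_mem_tensDeg d _) (adB_mem_tensDeg d _)⟩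

theorem gradedComm_a_mem {d : Fin 2 → ℕ} (ha : Odd (d 0)) {k : ℕ} (hk : k ≤ 2)
    {v : Tens (Fin 2)} (hv : v ∈ span ℚ (spanners d k)) :
    gradedComm d (FreeAlgebra.ι ℚ 0) v ∈ span ℚ (spanners d k) := by
  have a_mem := ι_mem_tensDeg d 0
  induction hv using span_induction with
  | zero => simp
  | add x y _ _ hx hy => rw [map_add]; exact add_mem hx hy
  | smul c x _ hx => rw [map_smul]; exact smul_mem _ _ hx
  | mem v hv =>
    interval_cases k
    · rcases hv with rfl | rfl
      · exact subset_span (Or.inr rfl)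
      · rw [gradedComm_self_right d ha a_mem]
        exact zero_mem _
    · obtain ⟨i, rfl⟩ := hv
      exact subset_span ⟨i + 1, rfl⟩
    · obtain ⟨⟨i, j⟩, rfl⟩ := hv
      rw [gradedComm_gradedComm d a_mem (adB_mem_tensDeg d i) (adB_mem_tensDeg d j)]
      exact add_mem (subset_span ⟨(i + 1, j), rfl⟩)
        (smul_mem _ _ (subset_span ⟨(i, j + 1), rfl⟩))

theorem gradedComm_mem_span_spanners {d : Fin 2 → ℕ} (ha : Odd (d 0)) {k l : ℕ} (hkl : k + l ≤ 2)
    {u v : Tens (Fin 2)} (hu : u ∈ span ℚ (spanners d k)) (hv : v ∈ span ℚ (spanners d l)) :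
    gradedComm d u v ∈ span ℚ (spanners d (k + l)) := by
  -- By antisymmetry the factor with fewer letters `b` may be put first.
  wlog hle : k ≤ l generalizing k l u v
  · have h : map₂ (gradedComm d) (span ℚ (spanners d k)) (span ℚ (spanners d l)) ≤
        span ℚ (spanners d (k + l)) := by
      rw [map₂_span_span, span_le]
      rintro _ ⟨u, hu, v, hv, rfl⟩
      obtain ⟨m, hm⟩ := exists_mem_tensDeg_of_mem_spanners d (by omega) hu
      obtain ⟨n, hn⟩ := exists_mem_tensDeg_of_mem_spanners d (by omega) hv
      simp only [SetLike.mem_coe]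
      rw [gradedComm_swap d hn hm, add_comm k l]
      exact smul_mem _ _ (this (by omega) (subset_span hv) (subset_span hu) (by omega))
    exact h (apply_mem_map₂ _ hu hv)
  have h : map₂ (gradedComm d) (span ℚ (spanners d k)) (span ℚ (spanners d l)) ≤
      span ℚ (spanners d (k + l)) := by
    rw [map₂_span_span, span_le]
    rintro _ ⟨u, hu, v, hv, rfl⟩
    obtain rfl | ⟨rfl, rfl⟩ : k = 0 ∨ (k = 1 ∧ l = 1) := by omega
    · rw [zero_add]
      rcases hu with rfl | rfl
      · exact gradedComm_a_mem ha (by omega) (subset_span hv)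
      · obtain ⟨n, hn⟩ := exists_mem_tensDeg_of_mem_spanners d (by omega) hv
        simp only [SetLike.mem_coe]
        rw [gradedComm_self_gradedComm d ha (ι_mem_tensDeg d 0) hn]
        exact smul_mem _ _ (gradedComm_a_mem ha (by omega)
          (gradedComm_a_mem ha (by omega) (subset_span hv)))
    · obtain ⟨i, rfl⟩ := hu
      obtain ⟨j, rfl⟩ := hv
      exact subset_span ⟨(i, j), rfl⟩
  exact h (apply_mem_map₂ _ hu hv)

theorem monomial_mem_span_spanners {d : Fin 2 → ℕ} (ha : Odd (d 0)) (m : FreeMagma (Fin 2))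
    (hm : occ 1 m ≤ 2) : (monomial d m).1 ∈ span ℚ (spanners d (occ 1 m)) := by
  induction m using FreeMagma.recOnMul with
  | ih1 x =>
    fin_cases x
    · exact subset_span (Or.inl rfl)
    · exact subset_span ⟨0, rfl⟩
  | ih2 s t hs ht =>
    have hst : occ 1 s + occ 1 t ≤ 2 := hm
    exact gradedComm_mem_span_spanners ha hst (hs (by omega)) (ht (by omega))

/-! ### The index set -/

/-- The bound `lastIndex n` selects the brackets `[i, j]` with `i ≤ j` and `i + j = n`, without the
vanishing ones, in which `i = j` is even. -/
theorem le_lastIndex_iff {n i : ℕ} (hi : 1 ≤ i) :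
    i ≤ lastIndex n ↔ 2 * i ≤ n ∧ (2 * i = n → Odd i) := by
  rw [lastIndex, Nat.odd_iff]
  split_ifs <;> omega

/-- The pairs `(n, i)` which index the basis elements `[i, n - i]`. -/
abbrev Index : Type := Σ n : ℕ, Finset.Icc 1 (lastIndex n)

/-- The basis elements `[i, n - i]`. -/
noncomputable def brFamily (d : Fin 2 → ℕ) (s : Index) : FreeLie d := br d s.2 (s.1 - s.2)

theorem Index.bounds (s : Index) :
    1 ≤ (s.2 : ℕ) ∧ 2 * (s.2 : ℕ) ≤ s.1 ∧ (2 * (s.2 : ℕ) = s.1 → Odd (s.2 : ℕ)) := by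
  obtain ⟨h1, h2⟩ := Finset.mem_Icc.1 s.2.2
  exact ⟨h1, (le_lastIndex_iff h1).1 h2⟩

theorem gradedComm_adB_mem_span {d : Fin 2 → ℕ} (ha : Odd (d 0)) (hb : Odd (d 1)) (i j : ℕ) :
    gradedComm d (adB d i) (adB d j) ∈ span ℚ (Set.range fun s => (brFamily d s).1) := by
  wlog hij : i ≤ j generalizing i j
  · rw [gradedComm_swap d (adB_mem_tensDeg d j) (adB_mem_tensDeg d i)]
    exact smul_mem _ _ (this j i (by omega))
  by_cases hodd : i = j ∧ Odd i
  · -- `ad^i(a)(b)` has even degree, so its bracket with itself vanishes.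
    obtain ⟨rfl, hi⟩ := hodd
    rw [gradedComm_adB ha hb, (hi.add_one.mul_left _).neg_one_pow, one_smul, sub_self]
    exact zero_mem _
  · have h : i + 1 ≤ lastIndex (i + j + 2) := by
      rw [le_lastIndex_iff (by omega)]
      refine ⟨by omega, fun h => ?_⟩
      have : ¬ Odd i := fun hi => hodd ⟨by omega, hi⟩
      exact (Nat.not_odd_iff_even.1 this).add_one
    refine subset_span ⟨⟨i + j + 2, ⟨i + 1, Finset.mem_Icc.2 ⟨by omega, h⟩⟩⟩, ?_⟩
    simp only [brFamily, br_coe]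
    congr 2
    omega

/-! ### Linear independence -/

/-- The degree at most two part of the free algebra on generators `x₀, x₁, …`: scalars, linear
combinations of the `xᵢ`, and linear combinations of the products `xᵢ xⱼ`. -/
abbrev Trunc : Type := ℚ × (ℕ →₀ ℚ) × (ℕ × ℕ →₀ ℚ)

/-- Left multiplication by `xᵢ` on the truncated free algebra; products of three generators are
set to zero. -/
noncomputable def leftMul (i : ℕ) : Module.End ℚ Trunc :=
  LinearMap.prod 0 (LinearMap.prod
    ((Finsupp.lsingle i : ℚ →ₗ[ℚ] ℕ →₀ ℚ) ∘ₗ LinearMap.fst ℚ _ _)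
    (Finsupp.lmapDomain ℚ ℚ (fun j => (i, j)) ∘ₗ LinearMap.fst ℚ _ _ ∘ₗ LinearMap.snd ℚ _ _))

/-- The odd derivation `xᵢ ↦ xᵢ₊₁` on the truncated free algebra, where `xᵢ` has the parity
of `i + 1`. -/
noncomputable def shiftDer : Module.End ℚ Trunc :=
  LinearMap.prod 0 (LinearMap.prod
    (Finsupp.lmapDomain ℚ ℚ (· + 1) ∘ₗ LinearMap.fst ℚ _ _ ∘ₗ LinearMap.snd ℚ _ _)
    (Finsupp.linearCombination ℚ (fun p : ℕ × ℕ => Finsupp.single (p.1 + 1, p.2) (1 : ℚ) +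
      (-1 : ℚ) ^ (p.1 + 1) • Finsupp.single (p.1, p.2 + 1) (1 : ℚ)) ∘ₗ
      LinearMap.snd ℚ _ _ ∘ₗ LinearMap.snd ℚ _ _))

theorem leftMul_apply (i : ℕ) (c : ℚ) (v : ℕ →₀ ℚ) (w : ℕ × ℕ →₀ ℚ) :
    leftMul i (c, v, w) = (0, Finsupp.single i c, Finsupp.mapDomain (fun j => (i, j)) v) := rfl

/-- The multiplication by `xᵢ₊₁` is the graded commutator of the derivation with the
multiplication by `xᵢ`. -/
theorem leftMul_succ (i : ℕ) :
    leftMul (i + 1) = shiftDer * leftMul i - (-1 : ℚ) ^ (i + 1) • (leftMul i * shiftDer) := by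
  ext <;> simp [leftMul, shiftDer, Finsupp.mapDomain_single, Finsupp.linearCombination_single]

/-- The action of the tensor algebra on the truncated free algebra in which `a` acts as the
derivation `xᵢ ↦ xᵢ₊₁` and `b` as the multiplication by `x₀`. -/
noncomputable def action : Tens (Fin 2) →ₐ[ℚ] Module.End ℚ Trunc :=
  FreeAlgebra.lift ℚ ![shiftDer, leftMul 0]

theorem action_adB {d : Fin 2 → ℕ} (ha : Odd (d 0)) (hb : Odd (d 1)) (i : ℕ) :
    action (adB d i) = leftMul i := by
  induction i with
  | zero => simp [adB, action]
  | succ i ih =>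
    have h0 : action (FreeAlgebra.ι ℚ 0) = shiftDer := by simp [action]
    rw [adB, gradedComm_of_homogeneous d (ι_mem_tensDeg d 0) (adB_mem_tensDeg d i), pow_mul,
      ha.neg_one_pow, neg_one_pow_degree_adB ha hb, leftMul_succ]
    simp only [map_sub, map_mul, map_smul, ih, h0]

/-- The coefficient of `xᵢ xⱼ` in `u · 1`, for the action on the truncated free algebra. -/
noncomputable def coeffDual (i j : ℕ) : Tens (Fin 2) →ₗ[ℚ] ℚ :=
  Finsupp.lapply (i, j) ∘ₗ LinearMap.snd ℚ _ _ ∘ₗ LinearMap.snd ℚ _ _ ∘ₗ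
    LinearMap.applyₗ ((1, 0, 0) : Trunc) ∘ₗ action.toLinearMap

theorem coeffDual_gradedComm {d : Fin 2 → ℕ} (ha : Odd (d 0)) (hb : Odd (d 1)) (i j k l : ℕ) :
    coeffDual i j (gradedComm d (adB d k) (adB d l)) =
      (if k = i ∧ l = j then 1 else 0) -
        (-1 : ℚ) ^ ((k + 1) * (l + 1)) * (if l = i ∧ k = j then 1 else 0) := by
  rw [gradedComm_adB ha hb]
  simp [coeffDual, action_adB ha hb, leftMul_apply, Finsupp.mapDomain_single,
    Finsupp.single_apply]

theorem linearIndependent_brFamily {d : Fin 2 → ℕ} (ha : Odd (d 0)) (hb : Odd (d 1)) :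
    LinearIndependent ℚ fun s => (brFamily d s).1 := by
  -- The coefficient of `xᵢ₋₁ xⱼ₋₁`, where `(i, j)` belongs to `s`, singles out the bracket of
  -- index `s`; it is `2` on the square of an odd element.
  have key (s t : Index) : coeffDual (s.2 - 1) (s.1 - s.2 - 1) (brFamily d t).1 =
      if s = t then (if 2 * (s.2 : ℕ) = s.1 then 2 else 1) else 0 := by
    have hs := s.bounds
    have ht := t.bounds
    have hst : s = t ↔ s.1 = t.1 ∧ (s.2 : ℕ) = t.2 := by
      constructor
      · rintro rfl
        exact ⟨rfl, rfl⟩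
      · obtain ⟨n, i⟩ := s
        obtain ⟨m, j⟩ := t
        rintro ⟨h, h'⟩
        obtain rfl : n = m := h
        obtain rfl : i = j := Subtype.ext h'
        rfl
    rw [brFamily, br_coe, coeffDual_gradedComm ha hb]
    by_cases h : s = t
    · subst h
      by_cases h2 : 2 * (s.2 : ℕ) = s.1
      · have h3 : s.1 - (s.2 : ℕ) = s.2 := by omega
        have h4 : (s.2 : ℕ) - 1 + 1 = s.2 := by omega
        rw [h3, h4, ((hs.2.2 h2).mul (hs.2.2 h2)).neg_one_pow]
        simp [h2]
        norm_num
      · have : ¬ (s.1 - (s.2 : ℕ) - 1 = s.2 - 1 ∧ (s.2 : ℕ) - 1 = s.1 - s.2 - 1) := by omega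
        simp [h2, this]
    · rw [if_neg h]
      rw [hst] at h
      rw [if_neg (by omega), if_neg (by omega)]
      simp
  rw [linearIndependent_iff]
  intro c hc
  ext s
  have h := congrArg (coeffDual (s.2 - 1) (s.1 - s.2 - 1)) hc
  rw [Finsupp.linearCombination_apply, Finsupp.sum, map_sum, map_zero] at h
  simp only [map_smul, key, smul_eq_mul, mul_ite, mul_zero, Finset.sum_ite_eq] at h
  by_contra hs
  rw [if_pos (by simpa using hs)] at h
  split_ifs at h <;> simp_all

/-! ### Word length -/

/-- The algebra automorphism which doubles every generator; it multiplies words of length `n`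
by `2 ^ n`. -/
noncomputable def doubling (X : Type) : Tens X →ₐ[ℚ] Tens X :=
  FreeAlgebra.lift ℚ fun x => (2 : ℚ) • FreeAlgebra.ι ℚ x

theorem doubling_parity {X : Type} (d : X → ℕ) (u : Tens X) :
    doubling X (parity d u) = parity d (doubling X u) := by
  have : (doubling X).comp (parity d) = (parity d).comp (doubling X) := by
    ext x
    simp [doubling, parity, smul_comm (2 : ℚ)]
  exact DFunLike.congr_fun this u

theorem doubling_gradedComm {X : Type} (d : X → ℕ) (u v : Tens X) :
    doubling X (gradedComm d u v) = gradedComm d (doubling X u) (doubling X v) := by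
  simp [gradedComm, doubling_parity]

theorem doubling_monomial {X : Type} (d : X → ℕ) (m : FreeMagma X) :
    doubling X (monomial d m).1 = (2 : ℚ) ^ m.length • (monomial d m).1 := by
  induction m using FreeMagma.recOnMul with
  | ih1 x => simp [monomial, gen, doubling, FreeMagma.length]
  | ih2 s t hs ht =>
    change doubling X (gradedComm d (monomial d s).1 (monomial d t).1) =
      (2 : ℚ) ^ (s.length + t.length) • gradedComm d (monomial d s).1 (monomial d t).1
    rw [doubling_gradedComm, hs, ht]
    simp [smul_smul, pow_add, mul_comm]

theorem doubling_wlPart {X : Type} (d : X → ℕ) {n : ℕ} {u : FreeLie d} (hu : u ∈ wlPart d n) :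
    doubling X u.1 = (2 : ℚ) ^ n • u.1 := by
  induction hu using span_induction with
  | zero => simp
  | add x y _ _ hx hy => simp [hx, hy]
  | smul c x _ hx => simp [hx, smul_comm c]
  | mem u hu =>
    obtain ⟨m, rfl, rfl⟩ := hu
    exact doubling_monomial d m

/-- A bracket monomial whose value is `ad^i(a)(b)`. -/
def adMonomial : ℕ → FreeMagma (Fin 2)
  | 0 => .of 1
  | i + 1 => .mul (.of 0) (adMonomial i)

theorem monomial_adMonomial (d : Fin 2 → ℕ) (i : ℕ) :
    monomial d (adMonomial i) = adPow d i (gen d 0) (gen d 1) := by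
  induction i with
  | zero => rfl
  | succ i ih =>
    rw [adPow, Function.iterate_succ_apply', ← adPow, ← ih]
    rfl

theorem occ_adMonomial (i : ℕ) : occ 1 (adMonomial i) = 1 := by
  induction i with
  | zero => rfl
  | succ i ih => simp [adMonomial, occ, ih]

theorem length_adMonomial (i : ℕ) : (adMonomial i).length = i + 1 := by
  induction i with
  | zero => rfl
  | succ i ih => simp [adMonomial, FreeMagma.length, ih, add_comm]

theorem br_mem_wlPartIn (d : Fin 2 → ℕ) (i j : ℕ) : br d i j ∈ wlPartIn d 1 2 :=
  subset_span ⟨.mul (adMonomial (i - 1)) (adMonomial (j - 1)), by simp [occ, occ_adMonomial],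
    by simp only [monomial, monomial_adMonomial, br]⟩

theorem br_mem_wlPart (d : Fin 2 → ℕ) {i j : ℕ} (hi : 1 ≤ i) (hj : 1 ≤ j) :
    br d i j ∈ wlPart d (i + j) :=
  subset_span ⟨.mul (adMonomial (i - 1)) (adMonomial (j - 1)), by
    simp only [FreeMagma.length, length_adMonomial]; omega,
    by simp only [monomial, monomial_adMonomial, br]⟩

theorem brFamily_mem_wlPart (d : Fin 2 → ℕ) (s : Index) : brFamily d s ∈ wlPart d s.1 := by
  have := s.bounds
  have h := br_mem_wlPart d (i := s.2) (j := s.1 - s.2) (by omega) (by omega)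
  rwa [Nat.add_sub_cancel' (by omega)] at h

/-! ### The bases -/

theorem span_brFamily {d : Fin 2 → ℕ} (ha : Odd (d 0)) (hb : Odd (d 1)) :
    span ℚ (Set.range (brFamily d)) = wlPartIn d 1 2 := by
  apply le_antisymm
  · rw [span_le]
    rintro _ ⟨s, rfl⟩
    exact br_mem_wlPartIn d _ _
  · rw [wlPartIn, span_le]
    rintro _ ⟨m, hm, rfl⟩
    have h := monomial_mem_span_spanners ha m hm.le
    rw [hm] at h
    have hle : span ℚ (spanners d 2) ≤ (span ℚ (Set.range (brFamily d))).map
        (lieSub d).subtype := by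
      rw [map_span, ← Set.range_comp, span_le]
      rintro _ ⟨p, rfl⟩
      exact gradedComm_adB_mem_span ha hb _ _
    obtain ⟨u, hu, hum⟩ := hle h
    rwa [← Subtype.ext (a1 := u) hum]

theorem span_brFamily_inf {d : Fin 2 → ℕ} (ha : Odd (d 0)) (hb : Odd (d 1)) (n : ℕ) :
    span ℚ (Set.range fun i : Finset.Icc 1 (lastIndex n) => br d i (n - i)) =
      wlPartIn d 1 2 ⊓ wlPart d n := by
  apply le_antisymm
  · rw [span_le]
    rintro _ ⟨i, rfl⟩
    exact ⟨br_mem_wlPartIn d _ _, brFamily_mem_wlPart d ⟨n, i⟩⟩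
  · rintro u ⟨hu, hun⟩
    rw [← span_brFamily ha hb, SetLike.mem_coe, Finsupp.mem_span_range_iff_exists_finsupp] at hu
    obtain ⟨c, rfl⟩ := hu
    -- Comparing the two expressions for the doubled element, the coefficient of a bracket of
    -- word length `m ≠ n` is annihilated by `2 ^ m - 2 ^ n`.
    have h := doubling_wlPart d hun
    have hsum : ∑ s ∈ c.support, (c s * (2 ^ s.1 - 2 ^ n)) • (brFamily d s).1 = 0 := by
      simp only [Finsupp.sum, AddSubmonoidClass.coe_finsetSum, coe_smul, map_sum, map_smul,
        doubling_wlPart d (brFamily_mem_wlPart d _), Finset.smul_sum] at h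
      rw [← sub_eq_zero, ← Finset.sum_sub_distrib] at h
      rw [← h]
      refine Finset.sum_congr rfl fun s _ => ?_
      module
    refine sum_mem fun s hs => smul_mem _ _ (subset_span ?_)
    have h0 := linearIndependent_iff'.1 (linearIndependent_brFamily ha hb) _ _ hsum s hs
    rw [mul_eq_zero, or_iff_right (Finsupp.mem_support_iff.1 hs), sub_eq_zero] at h0
    obtain ⟨m, i⟩ := s
    obtain rfl : m = n := Nat.pow_right_injective le_rfl (by exact_mod_cast h0)
    exact ⟨i, rfl⟩

theorem exists_basis_of_span_eq {ι R M : Type*} [Ring R] [AddCommGroup M] [Module R M]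
    {v : ι → M} (hv : LinearIndependent R v) {W : Submodule R M}
    (hW : span R (Set.range v) = W) : ∃ B : Module.Basis ι R W, ∀ i, (B i : M) = v i := by
  subst hW
  exact ⟨Module.Basis.span hv, fun i => by rw [Module.Basis.span_apply]⟩

theorem brFamily_mem_degPart (d : Fin 2 → ℕ) (s : Index) :
    brFamily d s ∈ degPart d ((s.1 - 2) * d 0 + 2 * d 1) := by
  have hs := s.bounds
  change (br d s.2 (s.1 - s.2)).1 ∈ tensDeg d _
  rw [br_coe, show s.1 - 2 = (s.2 - 1) + (s.1 - s.2 - 1) by omega,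
    show ((s.2 - 1 : ℕ) + (s.1 - s.2 - 1 : ℕ)) * d 0 + 2 * d 1 =
      ((s.2 - 1 : ℕ) * d 0 + d 1) + ((s.1 - s.2 - 1 : ℕ) * d 0 + d 1) by ring]
  exact gradedComm_mem_tensDeg d (adB_mem_tensDeg d _) (adB_mem_tensDeg d _)

end FreeGradedLie

theorem mainTheorem2 (d : Fin 2 → ℕ) (ha : Odd (d 0)) (hb : Odd (d 1)) :
    -- the brackets `[i, n - i]`, for all `n`, form a homogeneous basis of the part of
    -- word length 2 in `b`
    (∃ B : Module.Basis (Σ n : ℕ, Finset.Icc 1 (FreeGradedLie.lastIndex n)) ℚ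
        (FreeGradedLie.wlPartIn d 1 2),
      ∀ s, (B s : FreeGradedLie.FreeLie d) = FreeGradedLie.br d s.2 (s.1 - s.2) ∧
        (B s : FreeGradedLie.FreeLie d) ∈
          FreeGradedLie.degPart d ((s.1 - 2) * d 0 + 2 * d 1)) ∧
    -- in each word length `n ≥ 1`: the basis and the dimension
    ∀ n : ℕ, 1 ≤ n →
      (∃ B : Module.Basis (Finset.Icc 1 (FreeGradedLie.lastIndex n)) ℚ
          ↥(FreeGradedLie.wlPartIn d 1 2 ⊓ FreeGradedLie.wlPart d n),
        ∀ i, (B i : FreeGradedLie.FreeLie d) = FreeGradedLie.br d i (n - i)) ∧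
      (n % 4 = 0 →
        (Module.finrank ℚ ↥(FreeGradedLie.wlPartIn d 1 2 ⊓ FreeGradedLie.wlPart d n) : ℚ)
          = (n : ℚ) / 2 - 1) ∧
      (n % 4 = 1 ∨ n % 4 = 3 →
        (Module.finrank ℚ ↥(FreeGradedLie.wlPartIn d 1 2 ⊓ FreeGradedLie.wlPart d n) : ℚ)
          = ((n : ℚ) - 1) / 2) ∧
      (n % 4 = 2 →
        (Module.finrank ℚ ↥(FreeGradedLie.wlPartIn d 1 2 ⊓ FreeGradedLie.wlPart d n) : ℚ)
          = (n : ℚ) / 2) := by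
  have hli : LinearIndependent ℚ (FreeGradedLie.brFamily d) :=
    .of_comp (FreeGradedLie.lieSub d).subtype (FreeGradedLie.linearIndependent_brFamily ha hb)
  refine ⟨?_, fun n hn => ?_⟩
  · obtain ⟨B, hB⟩ := FreeGradedLie.exists_basis_of_span_eq hli
      (FreeGradedLie.span_brFamily ha hb)
    exact ⟨B, fun s => ⟨hB s, hB s ▸ FreeGradedLie.brFamily_mem_degPart d s⟩⟩
  · obtain ⟨B, hB⟩ := FreeGradedLie.exists_basis_of_span_eq
      (hli.comp (Sigma.mk n) sigma_mk_injective) (FreeGradedLie.span_brFamily_inf ha hb n)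
    have hdim : Module.finrank ℚ
        ↥(FreeGradedLie.wlPartIn d 1 2 ⊓ FreeGradedLie.wlPart d n) =
          FreeGradedLie.lastIndex n := by
      rw [Module.finrank_eq_card_basis B]
      simp
    refine ⟨⟨B, hB⟩, fun h => ?_, fun h => ?_, fun h => ?_⟩
    · have h2 : 2 * FreeGradedLie.lastIndex n + 2 = n := by
        rw [FreeGradedLie.lastIndex, if_pos h]; omega
      rw [hdim, eq_sub_iff_add_eq, eq_div_iff two_ne_zero]
      exact_mod_cast (by omega : (FreeGradedLie.lastIndex n + 1) * 2 = n)
    · have h2 : 2 * FreeGradedLie.lastIndex n + 1 = n := by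
        rw [FreeGradedLie.lastIndex, if_neg (by omega), if_neg (by omega)]; omega
      rw [hdim, eq_div_iff two_ne_zero, eq_sub_iff_add_eq]
      exact_mod_cast (by omega : FreeGradedLie.lastIndex n * 2 + 1 = n)
    · have h2 : 2 * FreeGradedLie.lastIndex n = n := by
        rw [FreeGradedLie.lastIndex, if_neg (by omega), if_pos h]; omega
      rw [hdim, eq_div_iff two_ne_zero]
      exact_mod_cast (by omega : FreeGradedLie.lastIndex n * 2 = n)
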